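/- **Conventions.** A superring is a $\mathbb{Z}/2$-graded unital ring $R=R_{\bar 0}\oplus R_{\bar 1}$; it is assumed supercommutative ($xy=(-1)^{|x||y|}yx$ for homogeneous $x,y$), nontrivial ($1\neq 0$), and such that $2$ is a non-zerodivisor in $R$. It is Noetherian if every superideal (that is, $\mathbb{Z}/2$-graded ideal) is generated by finitely many homogeneous elements. An $R$-supermodule is a $\mathbb{Z}/2$-graded left $R$-module; two supermodules are isomorphic if there is a bijective $R$-linear map between them that preserves parity. A prime ideal of $R$ is an ideal $\mathfrak{p}$ such that $R/\mathfrak{p}$ is an integral domain. For a multiplicative set $S\subseteq R_{\bar 0}$ and an $R$-supermodule $M$, $S^{-1}M=S^{-1}M_{\bar 0}\oplus S^{-1}M_{\bar 1}$ is the localization; $R_{\mathfrak{p}}$ and $M_{\mathfrak{p}}$ are the localizations at $S=R_{\bar 0}\setminus\mathfrak{p}$. The total superring of fractions $K(R)$ is $S^{-1}R$, where $S$ is the set of even elements that are non-zerodivisors of $R$. An $R$-supermodule $M$ is invertible if it is generated by finitely many homogeneous elements and, for every prime ideal $\mathfrak{p}$ of $R$, $M_{\mathfrak{p}}\simeq R_{\mathfrak{p}}$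 as $R_{\mathfrak{p}}$-supermodules. A fractional superideal of $R$ is a graded $R$-submodule $N\subseteq K(R)$ (with the induced grading) for which there is a homogeneous non-zerodivisor $d\in R$ with $dN\subseteq R$, where $R$ is identified with its image in $K(R)$. **Proposition.** Let $R$ be a Noetherian superring. 1. Every invertible $R$-supermodule is isomorphic, as an $R$-supermodule, to a fractional superideal of $R$. 2. Every fractional superideal of $R$ that is invertible as an $R$-supermodule contains (the image in $K(R)$ of) an even element of $R$ that is a non-zerodivisor of $R$. -/

import Mathlib

universe u v w

namespace Super

open DirectSum OreLocalization

/-- A `ℤ/2`-graded ring is supercommutative if `x y = (-1)^{|x||y|} y x` for homogeneous `x, y`. -/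
class IsSupercommutative {R : Type u} [Ring R] (𝒜 : ZMod 2 → AddSubgroup R) : Prop where
  mul_comm' : ∀ (i j : ZMod 2) (x y : R), x ∈ 𝒜 i → y ∈ 𝒜 j →
    x * y = (-1) ^ (i.val * j.val) * (y * x)

/-- A submodule (or ideal) of a graded module is generated by finitely many homogeneous
elements. -/
def FGHomogeneous {R : Type u} [Ring R] {M : Type v} [AddCommGroup M] [Module R M]
    (ℳ : ZMod 2 → AddSubgroup M) (N : Submodule R M) : Prop :=
  ∃ s : Finset M, (∀ m ∈ s, SetLike.IsHomogeneousElem ℳ m) ∧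
    Submodule.span R (s : Set M) = N

/-- A superring is Noetherian if each superideal (homogeneous ideal) is generated by finitely many
homogeneous elements. (In a supercommutative ring a homogeneous left ideal is two-sided.) -/
def IsNoetherianSuperring {R : Type u} [Ring R] (𝒜 : ZMod 2 → AddSubgroup R) [GradedRing 𝒜] :
    Prop :=
  ∀ I : Ideal R, I.IsHomogeneous 𝒜 → FGHomogeneous 𝒜 I

/-- A multiplicative set of even elements of a superring. -/
structure EvenSubmonoid {R : Type u} [Ring R] (𝒜 : ZMod 2 → AddSubgroup R) extends
    Submonoid R where
  even' : ∀ x ∈ carrier, x ∈ 𝒜 0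

theorem coe_eq_add {X : Type u} [AddCommGroup X] (𝒳 : ZMod 2 → AddSubgroup X)
    (f : ⨁ i, 𝒳 i) : DirectSum.coeAddMonoidHom 𝒳 f = (f 0 : X) + f 1 := by
  classical
  rw [DirectSum.coeAddMonoidHom_eq_dfinsuppSum, DFinsupp.sum_eq_sum_fintype]
  · exact Fin.sum_univ_two _
  · simp

theorem EvenSubmonoid.smul_mem {R : Type u} [Ring R] {𝒜 : ZMod 2 → AddSubgroup R}
    (S : EvenSubmonoid 𝒜) {M : Type v} [AddCommGroup M] [Module R M]
    (ℳ : ZMod 2 → AddSubgroup M) [SetLike.GradedSMul 𝒜 ℳ]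
    (s : S.toSubmonoid) {i : ZMod 2} {m : M} (hm : m ∈ ℳ i) : s • m ∈ ℳ i := by
  have h := SetLike.GradedSMul.smul_mem (A := 𝒜) (B := ℳ) (S.even' _ s.2) hm
  rwa [vadd_eq_add, zero_add] at h

section Localization

variable {R : Type u} [Ring R] {𝒜 : ZMod 2 → AddSubgroup R} [GradedRing 𝒜]

theorem EvenSubmonoid.commute [IsSupercommutative 𝒜] (S : EvenSubmonoid 𝒜)
    (s : S.toSubmonoid) (r : R) : (s : R) * r = r * s := by
  have key : ∀ i : ZMod 2, ∀ y ∈ 𝒜 i, (s : R) * y = y * s := fun i y hy => by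
    have h := IsSupercommutative.mul_comm' (𝒜 := 𝒜) 0 i (s : R) y (S.even' _ s.2) hy
    simpa using h
  induction r using DirectSum.Decomposition.inductionOn 𝒜 with
  | zero => simp
  | @homogeneous i m => exact key i m m.2
  | add a b ha hb => rw [mul_add, add_mul, ha, hb]

/-- Even elements are central, so left fractions with denominators in a multiplicative set of
even elements can be formed as in the commutative case. -/
instance EvenSubmonoid.instOreSet [IsSupercommutative 𝒜] (S : EvenSubmonoid 𝒜) :
    OreSet S.toSubmonoid where
  ore_right_cancel r₁ r₂ s h := ⟨s, by rw [S.commute, S.commute, h]⟩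
  oreNum r _ := r
  oreDenom _ s := s
  ore_eq r s := S.commute s r

variable [IsSupercommutative 𝒜] (S : EvenSubmonoid 𝒜)
variable {M : Type v} [AddCommGroup M] [Module R M]

theorem EvenSubmonoid.div_add_div (m n : M) (s t : S.toSubmonoid) :
    (m /ₒ s : OreLocalization S.toSubmonoid M) + n /ₒ t = (t • m + s • n) /ₒ (t * s) := by
  rw [oreDiv_add_char s t (s : R) t (S.commute t s)]
  rfl

theorem EvenSubmonoid.div_eq_zero (m : M) (s : S.toSubmonoid) :
    (m /ₒ s : OreLocalization S.toSubmonoid M) = 0 ↔ ∃ t : S.toSubmonoid, (t : R) • m = 0 := by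
  constructor
  · intro h
    rw [OreLocalization.zero_def, oreDiv_eq_iff] at h
    obtain ⟨a, b, h1, h2⟩ := h
    refine ⟨a, ?_⟩
    have hb : (a : R) = b * s := by simpa using h2
    rw [hb, ← S.commute, mul_smul, ← h1, smul_zero, smul_zero]
  · rintro ⟨t, ht⟩
    rw [OreLocalization.expand' m s t, Submonoid.smul_def, ht, zero_oreDiv]

variable (ℳ : ZMod 2 → AddSubgroup M) [SetLike.GradedSMul 𝒜 ℳ]

/-- The grading of `S⁻¹M`: the component `(S⁻¹M)_i` is the set of fractions `m / s` with
`m ∈ M_i` and `s ∈ S`. -/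
def locGrading (i : ZMod 2) : AddSubgroup (OreLocalization S.toSubmonoid M) where
  carrier := {z | ∃ m ∈ ℳ i, ∃ s : S.toSubmonoid, z = m /ₒ s}
  zero_mem' := ⟨0, zero_mem _, 1, (zero_oreDiv 1).symm⟩
  add_mem' := by
    rintro _ _ ⟨m, hm, s, rfl⟩ ⟨n, hn, t, rfl⟩
    exact ⟨_, add_mem (S.smul_mem ℳ t hm) (S.smul_mem ℳ s hn), _, S.div_add_div m n s t⟩
  neg_mem' := by
    rintro _ ⟨m, hm, s, rfl⟩
    exact ⟨_, neg_mem hm, s, OreLocalization.neg_def m s⟩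

theorem locGrading_isInternal [Decomposition ℳ] : IsInternal (locGrading S ℳ) := by
  have hdec : ∀ m : M, (decompose ℳ m 0 : M) + decompose ℳ m 1 = m := fun m => by
    rw [← coe_eq_add]
    exact (decompose ℳ).symm_apply_apply m
  constructor
  · rw [injective_iff_map_eq_zero]
    intro f hf
    rw [coe_eq_add] at hf
    obtain ⟨m, hm, s, hms⟩ := (f 0).2
    obtain ⟨n, hn, t, hnt⟩ := (f 1).2
    rw [hms, hnt, S.div_add_div, S.div_eq_zero] at hf
    obtain ⟨a, ha⟩ := hf
    have h0 : a • t • m ∈ ℳ 0 := S.smul_mem ℳ a (S.smul_mem ℳ t hm)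
    have h1 : a • s • n ∈ ℳ 1 := S.smul_mem ℳ a (S.smul_mem ℳ s hn)
    have hz : a • t • m + a • s • n = 0 := by rw [← smul_add]; exact ha
    have hz0 : a • t • m = 0 := by
      have h := congrArg (fun x => (decompose ℳ x 0 : M)) hz
      simpa [decompose_add, decompose_of_mem_same ℳ h0,
        decompose_of_mem_ne ℳ h1 (show (1 : ZMod 2) ≠ 0 by decide)] using h
    have hz1 : a • s • n = 0 := by rwa [hz0, zero_add] at hz
    have e0 : f 0 = 0 := Subtype.ext (by
      rw [hms, ZeroMemClass.coe_zero, S.div_eq_zero]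
      exact ⟨a * t, by simpa [Submonoid.smul_def, mul_smul] using hz0⟩)
    have e1 : f 1 = 0 := Subtype.ext (by
      rw [hnt, ZeroMemClass.coe_zero, S.div_eq_zero]
      exact ⟨a * s, by simpa [Submonoid.smul_def, mul_smul] using hz1⟩)
    refine DFinsupp.ext fun i => ?_
    match i with
    | 0 => exact e0
    | 1 => exact e1
  · intro z
    induction z using OreLocalization.ind with
    | _ m s =>
      refine ⟨DirectSum.of (fun i => locGrading S ℳ i) 0
          ⟨(decompose ℳ m 0 : M) /ₒ s, _, (decompose ℳ m 0).2, s, rfl⟩ +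
        DirectSum.of (fun i => locGrading S ℳ i) 1
          ⟨(decompose ℳ m 1 : M) /ₒ s, _, (decompose ℳ m 1).2, s, rfl⟩, ?_⟩
      rw [map_add, DirectSum.coeAddMonoidHom_of, DirectSum.coeAddMonoidHom_of, add_oreDiv, hdec]

noncomputable instance locDecomposition [Decomposition ℳ] : Decomposition (locGrading S ℳ) :=
  (locGrading_isInternal S ℳ).chooseDecomposition

end Localization

/-- The multiplicative set of even elements outside a prime ideal `p`. -/
def evenPrimeCompl {R : Type u} [Ring R] (𝒜 : ZMod 2 → AddSubgroup R) [GradedRing 𝒜]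
    (p : Ideal R) [p.IsPrime] : EvenSubmonoid 𝒜 where
  carrier := {x | x ∈ 𝒜 0 ∧ x ∉ p}
  one_mem' := ⟨SetLike.GradedOne.one_mem, fun h => Ideal.IsPrime.ne_top' ((Ideal.eq_top_iff_one p).2 h)⟩
  mul_mem' := by
    rintro a b ⟨ha, ha'⟩ ⟨hb, hb'⟩
    exact ⟨by simpa using SetLike.GradedMul.mul_mem ha hb,
      fun h => (Ideal.IsPrime.mem_or_mem' h).elim ha' hb'⟩
  even' := fun _ h => h.1

/-- The multiplicative set of even elements that are non-zerodivisors of the whole superring. -/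
def evenNonZeroDivisors {R : Type u} [Ring R] (𝒜 : ZMod 2 → AddSubgroup R) [GradedRing 𝒜] :
    EvenSubmonoid 𝒜 where
  carrier := {x | x ∈ 𝒜 0 ∧ x ∈ nonZeroDivisors R}
  one_mem' := ⟨SetLike.GradedOne.one_mem, one_mem _⟩
  mul_mem' := by
    rintro a b ⟨ha, ha'⟩ ⟨hb, hb'⟩
    exact ⟨by simpa using SetLike.GradedMul.mul_mem ha hb, mul_mem ha' hb'⟩
  even' := fun _ h => h.1

/-- Isomorphism of supermodules: a bijective linear map preserving the parity. -/
def SuperIso (R : Type u) [Ring R] {M : Type v} [AddCommGroup M] [Module R M]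
    {N : Type w} [AddCommGroup N] [Module R N]
    (ℳ : ZMod 2 → AddSubgroup M) (𝒩 : ZMod 2 → AddSubgroup N) : Prop :=
  ∃ e : M ≃ₗ[R] N, ∀ i : ZMod 2, ∀ m ∈ ℳ i, e m ∈ 𝒩 i

section Invertible

variable {R : Type u} [Ring R] (𝒜 : ZMod 2 → AddSubgroup R) [GradedRing 𝒜] [IsSupercommutative 𝒜]

/-- A supermodule `M` is invertible if it is finitely generated and, for every prime ideal `p`
of `R`, the `R_p`-supermodules `M_p` and `R_p` are isomorphic. (`Ideal.IsPrime` is complete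
primeness: `x y ∈ p` implies `x ∈ p` or `y ∈ p`.) -/
def IsInvertible {M : Type v} [AddCommGroup M] [Module R M]
    (ℳ : ZMod 2 → AddSubgroup M) [SetLike.GradedSMul 𝒜 ℳ] : Prop :=
  FGHomogeneous ℳ (⊤ : Submodule R M) ∧
  ∀ (p : Ideal R) [p.IsPrime],
    SuperIso (OreLocalization (evenPrimeCompl 𝒜 p).toSubmonoid R)
      (locGrading (evenPrimeCompl 𝒜 p) ℳ) (locGrading (evenPrimeCompl 𝒜 p) 𝒜)

/-- The total superring of fractions `K(R)`. -/
abbrev TotalFractions : Type u := OreLocalization (evenNonZeroDivisors 𝒜).toSubmonoid R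

/-- The grading of `K(R)`. -/
abbrev totalGrading : ZMod 2 → AddSubgroup (TotalFractions 𝒜) :=
  locGrading (evenNonZeroDivisors 𝒜) 𝒜

/-- The localization morphism `R → K(R)`, `r ↦ r / 1`. -/
abbrev toTotalFractions : R →+* TotalFractions 𝒜 := numeratorRingHom

/-- The grading that an `R`-submodule of `K(R)` inherits: `N_i = N ∩ K(R)_i`. -/
def subGrading (N : Submodule R (TotalFractions 𝒜)) (i : ZMod 2) : AddSubgroup N :=
  (totalGrading 𝒜 i).comap N.subtype.toAddMonoidHom

instance subGrading_gradedSMul (N : Submodule R (TotalFractions 𝒜)) :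
    SetLike.GradedSMul 𝒜 (subGrading 𝒜 N) where
  smul_mem := by
    rintro i j a ⟨_, hx⟩ ha ⟨m, hm, s, rfl⟩
    refine ⟨a * m, by simpa using SetLike.GradedMul.mul_mem ha hm, s, ?_⟩
    change a • (m /ₒ s) = _
    rw [← oreDiv_one_smul, oreDiv_smul_char a m 1 s a s ((evenNonZeroDivisors 𝒜).commute s a),
      mul_one, smul_eq_mul]

/-- A fractional superideal of `R`: an `R`-subsupermodule `N` of `K(R)` (that is, a homogeneous
`R`-submodule) such that `d N ⊆ R` for some homogeneous non-zerodivisor `d` of `R`. -/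
def IsFractionalSuperideal (N : Submodule R (TotalFractions 𝒜)) : Prop :=
  N.IsHomogeneous (totalGrading 𝒜) ∧
  ∃ d : R, SetLike.IsHomogeneousElem 𝒜 d ∧ d ∈ nonZeroDivisors R ∧
    ∀ x ∈ N, ∃ r : R, d • x = toTotalFractions 𝒜 r

end Invertible

end Super

/-! Everything is reduced to commutative algebra over the even part `R₀`. Since 2 is a
non-zerodivisor, odd elements square to zero, so products of odd elements lie in every prime of
`R₀`, and a prime `P` of `R₀` lifts to the prime `P + R₁` of `R`. Invertibility thus gives, at each
prime of `R₀`, an even element that freely generates `M` locally (`exists_isLocalGenerator`).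
Moreover `R` is a Noetherian `R₀`-module, so it has finitely many associated primes, and an ideal of
`R₀` contained in none of them contains a non-zerodivisor of `R` (`exists_mem_nonZeroDivisors`).

For the first claim, local generators are glued into one even `m` that works at all associated
primes. Then `r ↦ r • m` is injective, and each `x` satisfies `s • x = r • m` with `s` an even
non-zerodivisor. The map `x ↦ r / s` embeds `M` in `K(R)`; finite generation bounds the
denominators.

For the second, if `N ∩ R₀` lay in an associated prime `P = ann x`, a local generator `n` of `N` at
`P` would give `d • n ∈ N ∩ R₀`. Then `x * d` kills `n`, so some `t ∉ P` kills `x * d`, hence `x`, a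
contradiction. -/

namespace Super

open DirectSum OreLocalization

/-! ### Even and odd components -/

section Graded

variable {X : Type u} [AddCommGroup X] (𝒳 : ZMod 2 → AddSubgroup X) [Decomposition 𝒳]

theorem exists_eq_even_add_odd (x : X) : ∃ a ∈ 𝒳 0, ∃ b ∈ 𝒳 1, x = a + b :=
  ⟨_, (decompose 𝒳 x 0).2, _, (decompose 𝒳 x 1).2, by
    rw [← coe_eq_add]
    exact ((decompose 𝒳).symm_apply_apply x).symm⟩

theorem eq_zero_of_even_of_odd {x : X} (h0 : x ∈ 𝒳 0) (h1 : x ∈ 𝒳 1) : x = 0 := by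
  rw [← decompose_of_mem_same 𝒳 h0, decompose_of_mem_ne 𝒳 h1 (by decide)]

theorem even_odd_ext {a b a' b' : X} (ha : a ∈ 𝒳 0) (hb : b ∈ 𝒳 1) (ha' : a' ∈ 𝒳 0)
    (hb' : b' ∈ 𝒳 1) (h : a + b = a' + b') : a = a' ∧ b = b' := by
  have e : a - a' = b' - b := by
    rw [sub_eq_sub_iff_add_eq_add, h, add_comm]
  have h0 : a - a' = 0 :=
    eq_zero_of_even_of_odd 𝒳 (sub_mem ha ha') (e ▸ sub_mem hb' hb)
  exact ⟨sub_eq_zero.1 h0, (sub_eq_zero.1 (e ▸ h0)).symm⟩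

end Graded

/-! ### Odd elements, the even part and its primes -/

theorem odd_smul_mem {R : Type u} [Ring R] (𝒜 : ZMod 2 → AddSubgroup R)
    {M : Type v} [AddCommGroup M] [Module R M] (ℳ : ZMod 2 → AddSubgroup M) [SetLike.GradedSMul 𝒜 ℳ]
    {a : R} (ha : a ∈ 𝒜 1) {i : ZMod 2} {m : M} (hm : m ∈ ℳ i) : a • m ∈ ℳ (1 + i) :=
  SetLike.GradedSMul.smul_mem (A := 𝒜) (B := ℳ) ha hm

/-- Supercommutativity gives `a * a = -(a * a)`, and 2 cancels. Every use of the hypothesis on 2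
goes through this fact. -/
theorem odd_sq_eq_zero {R : Type u} [Ring R] {𝒜 : ZMod 2 → AddSubgroup R}
    [IsSupercommutative 𝒜] (h2 : (2 : R) ∈ nonZeroDivisors R) {a : R} (ha : a ∈ 𝒜 1) :
    a * a = 0 := by
  have h := IsSupercommutative.mul_comm' (𝒜 := 𝒜) 1 1 a a ha ha
  have e : ((1 : ZMod 2).val * (1 : ZMod 2).val) = 1 := by decide
  rw [e, pow_one, neg_one_mul] at h
  refine (mem_nonZeroDivisors_iff.1 h2).1 _ ?_
  rw [two_mul]
  exact eq_neg_iff_add_eq_zero.1 h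

theorem even_of_homogeneous_nonZeroDivisor {R : Type u} [Ring R] [Nontrivial R]
    {𝒜 : ZMod 2 → AddSubgroup R} [IsSupercommutative 𝒜] (h2 : (2 : R) ∈ nonZeroDivisors R) {d : R}
    (hd : SetLike.IsHomogeneousElem 𝒜 d) (hd' : d ∈ nonZeroDivisors R) : d ∈ 𝒜 0 := by
  obtain ⟨i, hi⟩ := hd
  match i with
  | 0 => exact hi
  | 1 =>
    exact absurd ((mem_nonZeroDivisors_iff.1 hd').1 d (odd_sq_eq_zero h2 hi))
      (nonZeroDivisors.ne_zero hd')

variable {R : Type u} [Ring R] (𝒜 : ZMod 2 → AddSubgroup R) [GradedRing 𝒜]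

/-- The subring of even elements of a superring. -/
def evenSubring : Subring R where
  carrier := 𝒜 0
  one_mem' := SetLike.GradedOne.one_mem
  zero_mem' := zero_mem _
  add_mem' := add_mem
  neg_mem' := neg_mem
  mul_mem' ha hb := by simpa using SetLike.GradedMul.mul_mem ha hb

theorem odd_mul_odd_mem {𝒜 : ZMod 2 → AddSubgroup R} [GradedRing 𝒜] {a b : R} (ha : a ∈ 𝒜 1) (hb : b ∈ 𝒜 1) :
    a * b ∈ evenSubring 𝒜 :=
  SetLike.GradedMul.mul_mem ha hb

section Commutation

variable [IsSupercommutative 𝒜]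

theorem even_mul_comm (a : evenSubring 𝒜) (r : R) : (a : R) * r = r * a :=
  EvenSubmonoid.commute (𝒜 := 𝒜) ⟨(evenSubring 𝒜).toSubmonoid, fun _ h => h⟩ a r

instance : CommRing (evenSubring 𝒜) :=
  { (inferInstance : Ring (evenSubring 𝒜)) with
    mul_comm := fun a b => Subtype.ext (even_mul_comm 𝒜 a b) }

variable {M : Type v} [AddCommGroup M] [Module R M]

theorem even_smul_comm (a : evenSubring 𝒜) (r : R) (m : M) : a • r • m = r • a • m := by
  simp only [Subring.smul_def, smul_smul, even_mul_comm]

theorem even_smul_mem (ℳ : ZMod 2 → AddSubgroup M) [SetLike.GradedSMul 𝒜 ℳ]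
    (a : evenSubring 𝒜) {i : ZMod 2} {m : M} (hm : m ∈ ℳ i) : a • m ∈ ℳ i := by
  have h := SetLike.GradedSMul.smul_mem (A := 𝒜) (B := ℳ) a.2 hm
  rwa [vadd_eq_add, zero_add] at h

variable {𝒜}

/-- The element `a * b` has square zero because `a` does, and primes contain nilpotents. -/
theorem odd_mul_odd_mem_prime (h2 : (2 : R) ∈ nonZeroDivisors R) {P : Ideal (evenSubring 𝒜)}
    (hP : P.IsPrime) {a b : R} (ha : a ∈ 𝒜 1) (hb : b ∈ 𝒜 1) :
    (⟨a * b, odd_mul_odd_mem ha hb⟩ : evenSubring 𝒜) ∈ P := by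
  refine hP.mem_of_pow_mem 2 ?_
  have e : (⟨a * b, odd_mul_odd_mem ha hb⟩ : evenSubring 𝒜) ^ 2 = 0 := by
    rw [sq]
    refine Subtype.ext ?_
    change a * b * (a * b) = 0
    rw [← mul_assoc, even_mul_comm 𝒜 ⟨a * b, odd_mul_odd_mem ha hb⟩ a]
    change a * (a * b) * b = 0
    rw [← mul_assoc, odd_sq_eq_zero h2 ha, zero_mul, zero_mul]
  rw [e]
  exact zero_mem _

/-- Each prime ideal of the even part is the even part of a prime ideal of the superring. -/
theorem exists_isPrime_even_mem_iff (h2 : (2 : R) ∈ nonZeroDivisors R)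
    {P : Ideal (evenSubring 𝒜)} (hP : P.IsPrime) :
    ∃ p : Ideal R, p.IsPrime ∧ ∀ a : evenSubring 𝒜, (a : R) ∈ p ↔ a ∈ P := by
  have hodd : ∀ {a b : R} (ha : a ∈ 𝒜 1) (hb : b ∈ 𝒜 1),
      (⟨a * b, odd_mul_odd_mem ha hb⟩ : evenSubring 𝒜) ∈ P := odd_mul_odd_mem_prime h2 hP
  have hmul : ∀ {a b : R} {i j : ZMod 2}, a ∈ 𝒜 i → b ∈ 𝒜 j → a * b ∈ 𝒜 (i + j) :=
    fun ha hb => SetLike.GradedMul.mul_mem ha hb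
  have hexp : ∀ a b c d : R, (a + b) * (c + d) = (a * c + b * d) + (a * d + b * c) := by
    intros; noncomm_ring
  -- The lift is `P + R₁`; `hodd` makes it absorb multiplication by odd elements.
  let p : Ideal R :=
    { carrier := {x | ∃ a ∈ P, ∃ b ∈ 𝒜 1, x = (a : R) + b}
      zero_mem' := ⟨0, zero_mem _, 0, zero_mem _, by simp⟩
      add_mem' := by
        rintro _ _ ⟨a, ha, b, hb, rfl⟩ ⟨c, hc, d, hd, rfl⟩
        exact ⟨a + c, add_mem ha hc, b + d, add_mem hb hd, by
          rw [Subring.coe_add]; abel⟩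
      smul_mem' := by
        rintro r _ ⟨c, hc, d, hd, rfl⟩
        obtain ⟨a, ha, b, hb, rfl⟩ := exists_eq_even_add_odd 𝒜 r
        exact ⟨⟨a, ha⟩ * c + _, add_mem (P.mul_mem_left _ hc) (hodd hb hd), a * d + b * c,
          add_mem (by simpa using hmul ha hd) (by simpa using hmul hb c.2), hexp _ _ _ _⟩ }
  have hp : ∀ a : evenSubring 𝒜, (a : R) ∈ p ↔ a ∈ P := by
    refine fun a => ⟨?_, fun ha => ⟨a, ha, 0, zero_mem _, (add_zero _).symm⟩⟩
    rintro ⟨c, hc, d, hd, h⟩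
    rw [← add_zero (a : R)] at h
    rwa [Subtype.ext (even_odd_ext 𝒜 a.2 (zero_mem _) c.2 hd h).1]
  have hpodd : ∀ b ∈ 𝒜 1, b ∈ p := fun b hb => ⟨0, zero_mem _, b, hb, (zero_add _).symm⟩
  refine ⟨p, ⟨fun h => hP.ne_top ((Ideal.eq_top_iff_one P).2 ((hp 1).1 ?_)), ?_⟩, hp⟩
  · rw [h]; trivial
  · intro x y hxy
    obtain ⟨a, ha, b, hb, rfl⟩ := exists_eq_even_add_odd 𝒜 x
    obtain ⟨c, hc, d, hd, rfl⟩ := exists_eq_even_add_odd 𝒜 y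
    obtain ⟨e, he, f, hf, h⟩ := hxy
    rw [hexp] at h
    -- The even component of the product is `a * c + b * d`, and `b * d` is already in `P`.
    have h' := (even_odd_ext 𝒜 (add_mem (by simpa using hmul ha hc) (odd_mul_odd_mem hb hd))
      (add_mem (by simpa using hmul ha hd) (by simpa using hmul hb hc)) e.2 hf h).1
    have hac : (⟨a, ha⟩ : evenSubring 𝒜) * ⟨c, hc⟩ ∈ P := by
      have e1 : (⟨a, ha⟩ : evenSubring 𝒜) * ⟨c, hc⟩ = e - ⟨b * d, odd_mul_odd_mem hb hd⟩ :=
        Subtype.ext (eq_sub_of_add_eq h')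
      rw [e1]
      exact sub_mem he (hodd hb hd)
    refine (hP.mem_or_mem hac).imp (fun h => ?_) fun h => ?_
    · exact add_mem ((hp _).2 h) (hpodd b hb)
    · exact add_mem ((hp _).2 h) (hpodd d hd)

end Commutation

/-! ### Finiteness over the even part -/

section Noetherian

variable [IsSupercommutative 𝒜] {𝒜}

/-- The ideal generated by `W` is homogeneous, and finitely many generators can be taken from `W`
itself. In an `R`-combination of elements of degree `i`, the part of degree `i` only sees the even
parts of the coefficients. -/
theorem isNoetherian_homogeneous_part (hR : IsNoetherianSuperring 𝒜) (i : ZMod 2)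
    (W : Submodule (evenSubring 𝒜) R) (hW : ∀ w ∈ W, w ∈ 𝒜 i) : W.FG := by
  have hfg : (Ideal.span (W : Set R)).FG := by
    obtain ⟨s, -, hs⟩ := hR _ (Ideal.homogeneous_span 𝒜 (W : Set R) fun x hx => ⟨i, hW x hx⟩)
    exact ⟨s, hs⟩
  obtain ⟨F, hFW, hF⟩ := (Submodule.fg_span_iff_fg_span_finset_subset (R := R) (W : Set R)).1 hfg
  refine ⟨F, le_antisymm (Submodule.span_le.2 hFW) fun w hw => ?_⟩
  have key : ∀ z ∈ Submodule.span R (F : Set R),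
      (decompose 𝒜 z i : R) ∈ Submodule.span (evenSubring 𝒜) (F : Set R) := by
    intro z hz
    obtain ⟨f, -, rfl⟩ := Submodule.mem_span_finset.1 hz
    simp only [decompose_sum, smul_eq_mul, DirectSum.sum_apply, AddSubgroup.val_finsetSum]
    refine sum_mem fun x hx => ?_
    have h := coe_decompose_mul_add_of_right_mem 𝒜 (i := 0) (j := i) (a := f x) (hW x (hFW hx))
    rw [zero_add] at h
    rw [h]
    exact Submodule.smul_mem _ (decompose 𝒜 (f x) 0 : evenSubring 𝒜) (Submodule.subset_span hx)
  rw [← decompose_of_mem_same 𝒜 (hW w hw)]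
  refine key w ?_
  have h : w ∈ Submodule.span R (W : Set R) := Submodule.subset_span hw
  exact hF ▸ h

/-- A homogeneous component as a module over the even part. -/
def homogeneousPart (𝒜 : ZMod 2 → AddSubgroup R) [GradedRing 𝒜]
    [IsSupercommutative 𝒜] (i : ZMod 2) : Submodule (evenSubring 𝒜) R where
  __ := 𝒜 i
  smul_mem' a _ hx := even_smul_mem 𝒜 𝒜 a hx

theorem isNoetherian_over_even (hR : IsNoetherianSuperring 𝒜) : IsNoetherian (evenSubring 𝒜) R := by
  have h (i) : IsNoetherian (evenSubring 𝒜) (homogeneousPart 𝒜 i) :=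
    isNoetherian_submodule.2 fun W hW => isNoetherian_homogeneous_part hR i W fun w hw => hW hw
  have := h 0
  have := h 1
  have htop : homogeneousPart 𝒜 0 ⊔ homogeneousPart 𝒜 1 = ⊤ := by
    refine eq_top_iff.2 fun x _ => ?_
    obtain ⟨a, ha, b, hb, rfl⟩ := exists_eq_even_add_odd 𝒜 x
    exact Submodule.add_mem_sup ha hb
  have hsup : IsNoetherian (evenSubring 𝒜)
    (homogeneousPart 𝒜 0 ⊔ homogeneousPart 𝒜 1 : Submodule (evenSubring 𝒜) R) := inferInstance
  rw [htop] at hsup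
  exact isNoetherian_of_linearEquiv Submodule.topEquiv

theorem isNoetherianRing_even (hR : IsNoetherianSuperring 𝒜) :
    IsNoetherianRing (evenSubring 𝒜) := by
  have := isNoetherian_over_even hR
  exact isNoetherian_of_injective
    ({ toFun := Subtype.val, map_add' := fun _ _ => rfl, map_smul' := fun _ _ => rfl } :
      evenSubring 𝒜 →ₗ[evenSubring 𝒜] R) Subtype.val_injective

end Noetherian

/-! ### Local generators and their gluing -/

section LocalGenerator

variable {R : Type u} [Ring R] {𝒜 : ZMod 2 → AddSubgroup R} [GradedRing 𝒜]
  [IsSupercommutative 𝒜] {M : Type v} [AddCommGroup M] [Module R M]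

/-- `m` generates the localization of `M` at the prime `P` of the even part freely. -/
structure IsLocalGenerator (P : Ideal (evenSubring 𝒜)) (m : M) : Prop where
  torsion : ∀ r : R, r • m = 0 → ∃ t : evenSubring 𝒜, t ∉ P ∧ t • r = 0
  surj : ∀ x : M, ∃ t : evenSubring 𝒜, t ∉ P ∧ ∃ r : R, t • x = r • m

theorem EvenSubmonoid.div_eq_div {S : EvenSubmonoid 𝒜} {m n : M} {s t : S.toSubmonoid}
    (h : (m /ₒ s : OreLocalization S.toSubmonoid M) = n /ₒ t) :
    ∃ a : S.toSubmonoid, a • t • m = a • s • n := by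
  rw [← sub_eq_zero, sub_eq_add_neg, OreLocalization.neg_def, S.div_add_div, S.div_eq_zero] at h
  obtain ⟨a, ha⟩ := h
  refine ⟨a, ?_⟩
  rw [smul_neg, ← sub_eq_add_neg, smul_sub] at ha
  exact sub_eq_zero.1 ha

/-- The preimage of 1 under the local isomorphism is a fraction `m / s`, and its numerator generates
because `s` is invertible. Only the existence of a splitting is assumed in `hℳ`, so that
`subGrading` qualifies directly. -/
theorem exists_isLocalGenerator (h2 : (2 : R) ∈ nonZeroDivisors R)
    (ℳ : ZMod 2 → AddSubgroup M) [SetLike.GradedSMul 𝒜 ℳ]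
    (hℳ : ∀ m : M, ∃ a ∈ ℳ 0, ∃ b ∈ ℳ 1, m = a + b) (hM : IsInvertible 𝒜 ℳ)
    {P : Ideal (evenSubring 𝒜)} (hP : P.IsPrime) : ∃ m ∈ ℳ 0, IsLocalGenerator P m := by
  obtain ⟨p, hp, hpP⟩ := exists_isPrime_even_mem_iff h2 hP
  set S := evenPrimeCompl 𝒜 p with hS
  have hSP : ∀ s : S.toSubmonoid, (⟨s, s.2.1⟩ : evenSubring 𝒜) ∉ P := fun s h =>
    s.2.2 ((hpP _).2 h)
  obtain ⟨e, he⟩ := hM.2 p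
  obtain ⟨m, hm, s, hms⟩ : ∃ m ∈ ℳ 0, ∃ s : S.toSubmonoid, e (m /ₒ s) = 1 := by
    obtain ⟨z, hz⟩ := e.surjective 1
    induction z using OreLocalization.ind with
    | _ m s =>
      -- As 1 is even, the even part of the preimage already maps to 1.
      obtain ⟨a, ha, b, hb, rfl⟩ := hℳ m
      refine ⟨a, ha, s, ?_⟩
      rw [← add_oreDiv, map_add, ← add_zero (1 : OreLocalization S.toSubmonoid R)] at hz
      exact (even_odd_ext (locGrading S 𝒜) (he 0 _ ⟨a, ha, s, rfl⟩) (he 1 _ ⟨b, hb, s, rfl⟩)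
        ⟨1, SetLike.GradedOne.one_mem, 1, OreLocalization.one_def⟩ (zero_mem _) hz).1
  have hem : e (m /ₒ 1) = (s : R) /ₒ 1 := by
    have h : (m /ₒ 1 : OreLocalization S.toSubmonoid M) = ((s : R) /ₒ 1) • (m /ₒ s) :=
      OreLocalization.smul_cancel.symm
    rw [h, map_smul, hms, smul_eq_mul, mul_one]
  refine ⟨m, hm, ⟨fun r hr => ?_, fun x => ?_⟩⟩
  · have h : ((r * s : R) /ₒ (1 : S.toSubmonoid)) = 0 := by
      rw [← OreLocalization.mul_div_one, ← hem, ← smul_eq_mul, ← map_smul,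
        OreLocalization.smul_div_one, hr, zero_oreDiv, map_zero]
    obtain ⟨t, ht⟩ := (S.div_eq_zero _ _).1 h
    refine ⟨_, hSP (t * s), ?_⟩
    change (t : R) * s * r = 0
    rw [mul_assoc, S.commute s r]
    exact ht
  · obtain ⟨r, u, hru⟩ : ∃ r : R, ∃ u : S.toSubmonoid, e (x /ₒ 1) = r /ₒ u := by
      induction e (x /ₒ 1) using OreLocalization.ind with
      | _ r u => exact ⟨r, u, rfl⟩
    have h : (x /ₒ 1 : OreLocalization S.toSubmonoid M) = (r • m) /ₒ (s * u) := by
      apply e.injective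
      have h1 : ((r • m) /ₒ (s * u) : OreLocalization S.toSubmonoid M) = (r /ₒ u) • (m /ₒ s) := by
        rw [oreDiv_smul_char r m u s r s (S.commute s r)]
      rw [h1, map_smul, hms, hru, smul_eq_mul, mul_one]
    obtain ⟨a, ha⟩ := EvenSubmonoid.div_eq_div h
    rw [one_smul] at ha
    refine ⟨_, hSP (a * (s * u)), (a : R) * r, ?_⟩
    rw [mul_smul]
    change ((a * (s * u) : S.toSubmonoid) : R) • x = _
    rw [Submonoid.coe_mul, mul_smul]
    exact ha

/-- An element with a multiple `a • m`, `m` a local generator and `a` outside the prime, is a local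
generator. -/
theorem IsLocalGenerator.of_smul_eq {P : Ideal (evenSubring 𝒜)} (hP : P.IsPrime) {m y : M}
    (hm : IsLocalGenerator P m) {t a : evenSubring 𝒜} (ha : a ∉ P)
    (h : t • y = a • m) : IsLocalGenerator P y where
  torsion r hr := by
    have h1 : (r * a) • m = 0 := by
        rw [mul_smul, ← Subring.smul_def, ← h, ← even_smul_comm, hr, smul_zero]
    obtain ⟨t', ht', h'⟩ := hm.torsion _ h1
    refine ⟨t' * a, fun h => (hP.mem_or_mem h).elim ht' ha, ?_⟩
    rw [mul_smul, ← h', Subring.smul_def a, smul_eq_mul, even_mul_comm]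
  surj x := by
    obtain ⟨t', ht', r, hr⟩ := hm.surj x
    refine ⟨a * t', fun h => (hP.mem_or_mem h).elim ha ht', r * t, ?_⟩
    rw [mul_smul, hr, mul_smul, ← Subring.smul_def, h, even_smul_comm]

theorem IsLocalGenerator.mono {P Q : Ideal (evenSubring 𝒜)} (h : P ≤ Q) {m : M}
    (hm : IsLocalGenerator Q m) : IsLocalGenerator P m where
  torsion r hr := (hm.torsion r hr).imp fun _ ht => ⟨fun hP => ht.1 (h hP), ht.2⟩
  surj x := (hm.surj x).imp fun _ ht => ⟨fun hP => ht.1 (h hP), ht.2⟩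

/-- The elements of `M` that, locally at `P`, are multiples of `m` by elements of `P`. -/
def localMaximalSubmodule (P : Ideal (evenSubring 𝒜)) (hP : P.IsPrime) (m : M) :
    Submodule (evenSubring 𝒜) M where
  carrier := {y | ∃ t : evenSubring 𝒜, t ∉ P ∧ ∃ a ∈ P, t • y = a • m}
  zero_mem' := ⟨1, hP.one_notMem, 0, zero_mem _, by simp⟩
  add_mem' := by
    rintro y z ⟨t, ht, a, ha, h⟩ ⟨t', ht', a', ha', h'⟩
    refine ⟨t * t', fun h => (hP.mem_or_mem h).elim ht ht', t' * a + t * a',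
      add_mem (P.mul_mem_left _ ha) (P.mul_mem_left _ ha'), ?_⟩
    rw [smul_add, mul_smul t t' z, h', mul_comm t t', mul_smul, h, add_smul, mul_smul, mul_smul]
  smul_mem' := by
    rintro c y ⟨t, ht, a, ha, h⟩
    exact ⟨t, ht, c * a, P.mul_mem_left _ ha, by rw [smul_comm, h, mul_smul]⟩

/-- Locally `y` is a multiple of `m`; as both are even, the even part of the coefficient suffices,
and `c` brings it into `P`. -/
theorem smul_mem_localMaximalSubmodule {P : Ideal (evenSubring 𝒜)} (hP : P.IsPrime) {m y : M}
    {ℳ : ZMod 2 → AddSubgroup M} [Decomposition ℳ] [SetLike.GradedSMul 𝒜 ℳ] (hm : m ∈ ℳ 0)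
    (hy : y ∈ ℳ 0) (hgen : IsLocalGenerator P m) {c : evenSubring 𝒜} (hc : c ∈ P) :
    c • y ∈ localMaximalSubmodule P hP m := by
  obtain ⟨t, ht, r, h⟩ := hgen.surj y
  obtain ⟨a, ha, b, hb, rfl⟩ := exists_eq_even_add_odd 𝒜 r
  rw [add_smul, ← add_zero (t • y)] at h
  have h' := (even_odd_ext ℳ (even_smul_mem 𝒜 ℳ t hy) (zero_mem _)
    (even_smul_mem 𝒜 ℳ ⟨a, ha⟩ hm) (odd_smul_mem 𝒜 ℳ hb hm) h).1
  refine ⟨t, ht, c * ⟨a, ha⟩, P.mul_mem_right _ hc, ?_⟩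
  rw [smul_comm, h', mul_smul]

/-- Finitely many incomparable primes of the even part have a common local generator. -/
theorem exists_forall_isLocalGenerator (h2 : (2 : R) ∈ nonZeroDivisors R)
    (ℳ : ZMod 2 → AddSubgroup M) [Decomposition ℳ] [SetLike.GradedSMul 𝒜 ℳ]
    (hM : IsInvertible 𝒜 ℳ) (s : Finset (Ideal (evenSubring 𝒜))) (hs : ∀ P ∈ s, P.IsPrime)
    (hanti : ∀ P ∈ s, ∀ Q ∈ s, P ≤ Q → P = Q) :
    ∃ m ∈ ℳ 0, ∀ P ∈ s, IsLocalGenerator P m := by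
  classical
  have hgen : ∀ P : s, ∃ m ∈ ℳ 0, IsLocalGenerator P.1 m := fun P =>
    exists_isLocalGenerator h2 ℳ (exists_eq_even_add_odd ℳ) hM (hs P P.2)
  choose g hg0 hg using hgen
  -- A prime containing the intersection of the others would contain one of them.
  have havoid : ∀ P : s, ∃ c : evenSubring 𝒜, c ∉ P.1 ∧ ∀ Q : s, Q ≠ P → c ∈ Q.1 := by
    intro P
    have h : ¬ (s.erase P).inf id ≤ P.1 := by
      rw [(hs P P.2).inf_le']
      rintro ⟨Q, hQ, hQP⟩
      rw [Finset.mem_erase] at hQ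
      exact hQ.1 (hanti Q hQ.2 P P.2 hQP)
    obtain ⟨c, hc, hcP⟩ := SetLike.not_le_iff_exists.1 h
    refine ⟨c, hcP, fun Q hQ => ?_⟩
    exact (Finset.inf_le (f := id) (Finset.mem_erase.2 ⟨fun h => hQ (Subtype.ext h), Q.2⟩)) hc
  choose c hcP hc using havoid
  -- At `P`, every term with `Q ≠ P` is locally in `P • g P`, so the sum is a multiple of `g P` by a
  -- coefficient outside `P`.
  refine ⟨∑ Q : s, c Q • g Q, sum_mem fun Q _ => even_smul_mem 𝒜 ℳ _ (hg0 Q), fun P hP => ?_⟩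
  have hrest : ∑ Q ∈ Finset.univ.erase (⟨P, hP⟩ : s), c Q • g Q ∈
      localMaximalSubmodule P (hs P hP) (g ⟨P, hP⟩) := by
    refine sum_mem fun Q hQ => ?_
    exact smul_mem_localMaximalSubmodule (hs P hP) (hg0 _) (hg0 Q) (hg ⟨P, hP⟩)
      (hc Q ⟨P, hP⟩ (Finset.ne_of_mem_erase hQ).symm)
  obtain ⟨t, ht, a, ha, h⟩ := hrest
  refine (hg ⟨P, hP⟩).of_smul_eq (hs P hP) (t := t) (a := t * c ⟨P, hP⟩ + a) (fun hmem => ?_) ?_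
  · rw [Ideal.add_mem_iff_left _ ha] at hmem
    exact ((hs P hP).mem_or_mem hmem).elim ht (hcP ⟨P, hP⟩)
  · rw [← Finset.add_sum_erase _ _ (Finset.mem_univ (⟨P, hP⟩ : s)), smul_add, h, add_smul, mul_smul]

end LocalGenerator

/-! ### Associated primes and non-zerodivisors -/

section TotalFractions

variable {R : Type u} [Ring R] {𝒜 : ZMod 2 → AddSubgroup R} [GradedRing 𝒜]
  [IsSupercommutative 𝒜] {M : Type v} [AddCommGroup M] [Module R M]

theorem EvenSubmonoid.div_eq_div_of_smul_eq {S : EvenSubmonoid 𝒜} {m n : M} {s t : S.toSubmonoid}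
    (h : t • m = s • n) : (m /ₒ s : OreLocalization S.toSubmonoid M) = n /ₒ t := by
  have hst : s * t = t * s := Subtype.ext (S.commute s t)
  rw [OreLocalization.expand' m s t, OreLocalization.expand' n t s, h, hst]

theorem EvenSubmonoid.smul_div (S : EvenSubmonoid 𝒜) (a : R) (m : M) (s : S.toSubmonoid) :
    a • (m /ₒ s : OreLocalization S.toSubmonoid M) = (a • m) /ₒ s := by
  rw [← oreDiv_one_smul, oreDiv_smul_char a m 1 s a s (S.commute s a), mul_one]

theorem mem_nonZeroDivisors_of_even {a : evenSubring 𝒜} (h : ∀ r : R, a • r = 0 → r = 0) :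
    (a : R) ∈ nonZeroDivisors R :=
  mem_nonZeroDivisors_iff.2 ⟨fun r hr => h r hr,
    fun r hr => h r ((even_mul_comm 𝒜 a r).trans hr)⟩

theorem exists_mem_annihilator_iff (hR : IsNoetherianSuperring 𝒜) {P : Ideal (evenSubring 𝒜)}
    (hP : P ∈ associatedPrimes (evenSubring 𝒜) R) :
    ∃ x : R, ∀ a : evenSubring 𝒜, a ∈ P ↔ a • x = 0 := by
  have := isNoetherianRing_even hR
  obtain ⟨-, x, rfl⟩ := isAssociatedPrime_iff.1 hP
  exact ⟨x, fun a => by rw [Submodule.mem_colon_singleton, Submodule.mem_bot]⟩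

theorem finite_associatedPrimes_even (hR : IsNoetherianSuperring 𝒜) :
    (associatedPrimes (evenSubring 𝒜) R).Finite := by
  have := isNoetherianRing_even hR
  have := isNoetherian_over_even hR
  exact associatedPrimes.finite _ _

/-- Zero divisors on `R` form the union of the finitely many associated primes, so prime avoidance
applies. -/
theorem exists_mem_nonZeroDivisors (hR : IsNoetherianSuperring 𝒜) (J : Ideal (evenSubring 𝒜))
    (hJ : ∀ P ∈ associatedPrimes (evenSubring 𝒜) R, ¬ J ≤ P) :
    ∃ a ∈ J, (a : R) ∈ nonZeroDivisors R := by
  have := isNoetherianRing_even hR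
  by_contra! hcon
  have hsub : (J : Set (evenSubring 𝒜)) ⊆
      ⋃ P ∈ ((finite_associatedPrimes_even hR).toFinset : Set (Ideal (evenSubring 𝒜))), id P := by
    intro a ha
    rw [Set.Finite.coe_toFinset]
    have h : a ∈ ⋃ p ∈ associatedPrimes (evenSubring 𝒜) R, (p : Set (evenSubring 𝒜)) := by
      rw [biUnion_associatedPrimes_eq_zero_divisors]
      by_contra hz
      refine hcon a ha (mem_nonZeroDivisors_of_even fun r hr => ?_)
      by_contra hr0
      exact hz ⟨r, hr0, hr⟩
    exact h
  obtain ⟨P, hP, hle⟩ := (Ideal.subset_union_prime (f := id) ⊥ ⊥ fun P hP _ _ =>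
    IsAssociatedPrime.isPrime ((Set.Finite.mem_toFinset _).1 hP)).1 hsub
  exact hJ P ((Set.Finite.mem_toFinset _).1 hP) hle

/-- Local generators at the associated primes are generic generators. -/
theorem exists_isLocalGenerator_associatedPrimes (h2 : (2 : R) ∈ nonZeroDivisors R)
    (hR : IsNoetherianSuperring 𝒜)
    (ℳ : ZMod 2 → AddSubgroup M) [Decomposition ℳ] [SetLike.GradedSMul 𝒜 ℳ]
    (hM : IsInvertible 𝒜 ℳ) :
    ∃ m ∈ ℳ 0, ∀ P ∈ associatedPrimes (evenSubring 𝒜) R, IsLocalGenerator P m := by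
  have hfin := finite_associatedPrimes_even hR
  -- Maximal associated primes are incomparable, and a local generator at a prime remains one at
  -- every smaller prime.
  have hfin' : {P | Maximal (· ∈ associatedPrimes (evenSubring 𝒜) R) P}.Finite :=
    hfin.subset fun P hP => hP.1
  obtain ⟨m, hm, hgen⟩ := exists_forall_isLocalGenerator h2 ℳ hM hfin'.toFinset
    (fun P hP => IsAssociatedPrime.isPrime ((Set.Finite.mem_toFinset _).1 hP).1)
    fun P hP Q hQ hle => ((Set.Finite.mem_toFinset _).1 hP).eq_of_le
      ((Set.Finite.mem_toFinset _).1 hQ).1 hle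
  refine ⟨m, hm, fun P hP => ?_⟩
  obtain ⟨Q, hPQ, hQ⟩ := hfin.exists_le_maximal hP
  exact (hgen Q ((Set.Finite.mem_toFinset _).2 hQ)).mono hPQ

/-- The annihilator of a nonzero `r` lies in some associated prime `P`, whereas `torsion` at `P`
yields an annihilator outside `P`. -/
theorem eq_zero_of_smul_eq_zero (hR : IsNoetherianSuperring 𝒜) {m : M}
    (hm : ∀ P ∈ associatedPrimes (evenSubring 𝒜) R, IsLocalGenerator P m) {r : R}
    (hr : r • m = 0) : r = 0 := by
  have := isNoetherianRing_even hR
  by_contra hr0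
  obtain ⟨P, hP, hle⟩ := exists_le_isAssociatedPrime_of_isNoetherianRing (evenSubring 𝒜) r hr0
  obtain ⟨t, ht, htr⟩ := (hm P hP).torsion r hr
  exact ht (hle (by rwa [Submodule.mem_colon_singleton, Submodule.mem_bot]))

theorem exists_smul_eq_smul (hR : IsNoetherianSuperring 𝒜) {m : M}
    (hm : ∀ P ∈ associatedPrimes (evenSubring 𝒜) R, IsLocalGenerator P m) (x : M) :
    ∃ s : (evenNonZeroDivisors 𝒜).toSubmonoid, ∃ r : R, s • x = r • m := by
  let J : Ideal (evenSubring 𝒜) :=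
    { carrier := {a | ∃ r : R, a • x = r • m}
      zero_mem' := ⟨0, by simp⟩
      add_mem' := by
        rintro a b ⟨r, hr⟩ ⟨r', hr'⟩
        exact ⟨r + r', by rw [add_smul, hr, hr', add_smul]⟩
      smul_mem' := by
        rintro c a ⟨r, hr⟩
        exact ⟨c * r, by rw [smul_eq_mul, mul_smul, hr, mul_smul]; rfl⟩ }
  obtain ⟨a, ⟨r, hr⟩, ha⟩ := exists_mem_nonZeroDivisors hR J fun P hP hle => by
    obtain ⟨t, ht, h⟩ := (hm P hP).surj x
    exact ht (hle h)
  exact ⟨⟨a, a.2, ha⟩, r, hr⟩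

/-- Here a maximal ideal containing the annihilator of `x` is used, not an associated prime: locally
there `M` is free of rank one, and `s` cancels in `R`. -/
theorem IsInvertible.eq_zero_of_smul_eq_zero (h2 : (2 : R) ∈ nonZeroDivisors R)
    {ℳ : ZMod 2 → AddSubgroup M} [Decomposition ℳ] [SetLike.GradedSMul 𝒜 ℳ]
    (hM : IsInvertible 𝒜 ℳ) (s : (evenNonZeroDivisors 𝒜).toSubmonoid) {x : M} (hx : s • x = 0) :
    x = 0 := by
  by_contra hx0
  let J : Ideal (evenSubring 𝒜) := (⊥ : Submodule (evenSubring 𝒜) M).colon {x}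
  have hJ : ∀ a, a ∈ J ↔ a • x = 0 := fun a => by
    rw [Submodule.mem_colon_singleton, Submodule.mem_bot]
  obtain ⟨Q, hQ, hle⟩ := J.exists_le_maximal fun h => hx0 (by
    rw [← one_smul (evenSubring 𝒜) x, ← hJ, h]
    trivial)
  obtain ⟨m, -, hm⟩ := exists_isLocalGenerator h2 ℳ (exists_eq_even_add_odd ℳ) hM hQ.isPrime
  obtain ⟨t, ht, r, hr⟩ := hm.surj x
  obtain ⟨t', ht', h⟩ := hm.torsion ((s : R) * r) (by
    rw [mul_smul, ← hr, ← even_smul_comm]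
    change t • (s • x) = 0
    rw [hx, smul_zero])
  have hr0 : t' • r = 0 := by
    refine (mem_nonZeroDivisors_iff.1 s.2.2).1 _ ?_
    rw [← smul_eq_mul, ← even_smul_comm]
    exact h
  refine (hQ.isPrime.mem_or_mem (hle ((hJ (t' * t)).2 ?_))).elim ht' ht
  rw [mul_smul, hr, Subring.smul_def, ← mul_smul]
  change (t' • r) • m = 0
  rw [hr0, zero_smul]

end TotalFractions

/-! ### Embedding into the total fractions; non-zerodivisors in fractional superideals -/

section FractionalIdeals

variable {R : Type u} [Ring R] {𝒜 : ZMod 2 → AddSubgroup R} [GradedRing 𝒜]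
  [IsSupercommutative 𝒜]

theorem smul_toTotalFractions (a r : R) :
    a • toTotalFractions 𝒜 r = toTotalFractions 𝒜 (a * r) :=
  (evenNonZeroDivisors 𝒜).smul_div a r 1

theorem IsInvertible.exists_fractionalSuperideal (h2 : (2 : R) ∈ nonZeroDivisors R)
    (hR : IsNoetherianSuperring 𝒜) {M : Type v} [AddCommGroup M] [Module R M]
    {ℳ : ZMod 2 → AddSubgroup M} [Decomposition ℳ] [SetLike.GradedSMul 𝒜 ℳ]
    (hM : IsInvertible 𝒜 ℳ) :
    ∃ N : Submodule R (TotalFractions 𝒜),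
      IsFractionalSuperideal 𝒜 N ∧ SuperIso R ℳ (subGrading 𝒜 N) := by
  obtain ⟨m, hm0, hm⟩ := exists_isLocalGenerator_associatedPrimes h2 hR ℳ hM
  have hfree : ∀ {r r' : R}, r • m = r' • m → r = r' := fun {r r'} h =>
    sub_eq_zero.1 (Super.eq_zero_of_smul_eq_zero hR hm (by rw [sub_smul, h, sub_self]))
  have hcomm : ∀ (t : (evenNonZeroDivisors 𝒜).toSubmonoid) (r : R) (x : M),
      t • r • x = r • t • x := fun t => even_smul_comm 𝒜 ⟨t, t.2.1⟩
  have hex := exists_smul_eq_smul hR hm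
  choose s r hsr using hex
  -- The fraction does not depend on the chosen relation between `x` and `m`; linearity follows by
  -- exhibiting suitable relations.
  have key : ∀ {x : M} {t : (evenNonZeroDivisors 𝒜).toSubmonoid} {c : R}, t • x = c • m →
      (r x /ₒ s x : TotalFractions 𝒜) = c /ₒ t := by
    intro x t c h
    refine EvenSubmonoid.div_eq_div_of_smul_eq (hfree ?_)
    rw [smul_assoc, ← hsr, smul_assoc, ← h]
    exact hcomm t (s x) x
  let φ : M →ₗ[R] TotalFractions 𝒜 :=
    { toFun := fun x => r x /ₒ s x
      map_add' := fun x y => by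
        rw [EvenSubmonoid.div_add_div]
        refine key ?_
        rw [smul_add, mul_smul, hsr, add_smul, smul_assoc, smul_assoc, ← hsr y, mul_smul]
        congr 1
        exact hcomm (s y) (s x) y
      map_smul' := fun c x => by
        rw [RingHom.id_apply, EvenSubmonoid.smul_div]
        refine key ?_
        rw [hcomm, hsr, smul_assoc] }
  have hφ : ∀ {x : M} {t : (evenNonZeroDivisors 𝒜).toSubmonoid} {c : R}, t • x = c • m →
      φ x = c /ₒ t := key
  have hinj : Function.Injective φ := by
    rw [injective_iff_map_eq_zero]
    intro x hx
    obtain ⟨t, ht⟩ := ((evenNonZeroDivisors 𝒜).div_eq_zero _ _).1 ((hφ (hsr x)).symm.trans hx)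
    have h0 : r x = 0 := (mem_nonZeroDivisors_iff.1 t.2.2).1 _ ht
    exact hM.eq_zero_of_smul_eq_zero h2 (s x) (by rw [hsr, h0, zero_smul])
  have hpar : ∀ (i : ZMod 2), ∀ x ∈ ℳ i, φ x ∈ totalGrading 𝒜 i := by
    intro i x hx
    -- Since `m` is even, comparing components of `s x • x = r x • m` replaces `r x` by its part of
    -- degree `i`.
    obtain ⟨a, ha, b, hb, hab⟩ := exists_eq_even_add_odd 𝒜 (r x)
    have ham := even_smul_mem 𝒜 ℳ ⟨a, ha⟩ hm0
    have hbm := odd_smul_mem 𝒜 ℳ hb hm0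
    rw [add_zero] at hbm
    have h := hsr x
    have hsx := (evenNonZeroDivisors 𝒜).smul_mem ℳ (s x) hx
    rw [hab, add_smul] at h
    match i with
    | 0 =>
      rw [← add_zero (s x • x)] at h
      exact ⟨a, ha, s x, hφ (even_odd_ext ℳ hsx (zero_mem _) ham hbm h).1⟩
    | 1 =>
      rw [← zero_add (s x • x)] at h
      exact ⟨b, hb, s x, hφ (even_odd_ext ℳ (zero_mem _) hsx ham hbm h).2⟩
  refine ⟨LinearMap.range φ, ⟨?_, ?_⟩, LinearEquiv.ofInjective φ hinj, hpar⟩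
  · rintro i _ ⟨x, rfl⟩
    induction x using Decomposition.inductionOn ℳ with
    | zero => simp
    | @homogeneous j x =>
      by_cases hij : j = i
      · subst hij
        rw [decompose_of_mem_same _ (hpar j x x.2)]
        exact ⟨x, rfl⟩
      · rw [decompose_of_mem_ne _ (hpar j x x.2) hij]
        exact zero_mem _
    | add x y hx hy =>
      rw [map_add, decompose_add]
      exact add_mem hx hy
  · classical
    obtain ⟨F, -, hF⟩ := hM.1
    -- A common denominator for the generators serves for all of `M`.
    have hden : ∀ G : Finset M, ∃ t : (evenNonZeroDivisors 𝒜).toSubmonoid,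
        ∀ x ∈ G, ∃ c : R, t • x = c • m := by
      intro G
      induction G using Finset.induction_on with
      | empty => exact ⟨1, by simp⟩
      | insert x G _ ih =>
        obtain ⟨t, ht⟩ := ih
        refine ⟨t * s x, fun y hy => ?_⟩
        rcases Finset.mem_insert.1 hy with rfl | hy
        · exact ⟨t * r y, by rw [mul_smul, hsr, mul_smul]; rfl⟩
        · obtain ⟨c, hc⟩ := ht y hy
          refine ⟨s x * c, ?_⟩
          rw [mul_smul, mul_smul, ← hc]
          exact hcomm t (s x) y
    obtain ⟨t, ht⟩ := hden F
    refine ⟨t, ⟨0, t.2.1⟩, t.2.2, ?_⟩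
    rintro _ ⟨x, rfl⟩
    have hx : ∃ c : R, t • x = c • m := by
      have hx : x ∈ Submodule.span R (F : Set M) := hF ▸ Submodule.mem_top
      induction hx using Submodule.span_induction with
      | mem x hx => exact ht x hx
      | zero => exact ⟨0, by simp⟩
      | add x y _ _ hx hy =>
        obtain ⟨c, hc⟩ := hx
        obtain ⟨c', hc'⟩ := hy
        exact ⟨c + c', by rw [smul_add, hc, hc', add_smul]⟩
      | smul a x _ hx =>
        obtain ⟨c, hc⟩ := hx
        exact ⟨a * c, by rw [hcomm, hc, mul_smul]⟩
    obtain ⟨c, hc⟩ := hx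
    refine ⟨c, ?_⟩
    rw [hφ hc]
    exact ((evenNonZeroDivisors 𝒜).smul_div _ _ _).trans
      (EvenSubmonoid.div_eq_div_of_smul_eq (one_smul _ _))

theorem IsFractionalSuperideal.exists_even_nonZeroDivisor [Nontrivial R]
    (h2 : (2 : R) ∈ nonZeroDivisors R) (hR : IsNoetherianSuperring 𝒜)
    {N : Submodule R (TotalFractions 𝒜)} (hN : IsFractionalSuperideal 𝒜 N)
    (hinv : IsInvertible 𝒜 (subGrading 𝒜 N)) :
    ∃ r : R, r ∈ 𝒜 0 ∧ r ∈ nonZeroDivisors R ∧ toTotalFractions 𝒜 r ∈ N := by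
  obtain ⟨hhom, d, hd, hd', hdN⟩ := hN
  have hd0 := even_of_homogeneous_nonZeroDivisor h2 hd hd'
  have hdec : ∀ n : N, ∃ a ∈ subGrading 𝒜 N 0, ∃ b ∈ subGrading 𝒜 N 1, n = a + b := fun n =>
    ⟨⟨_, hhom 0 n.2⟩, (decompose (totalGrading 𝒜) (n : TotalFractions 𝒜) 0).2, ⟨_, hhom 1 n.2⟩,
      (decompose (totalGrading 𝒜) (n : TotalFractions 𝒜) 1).2, Subtype.ext (by
        rw [Submodule.coe_add, ← coe_eq_add]
        exact ((decompose (totalGrading 𝒜)).symm_apply_apply _).symm)⟩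
  let J : Ideal (evenSubring 𝒜) :=
    { carrier := {a | toTotalFractions 𝒜 a ∈ N}
      zero_mem' := by simp
      add_mem' := fun {a b} ha hb => by
        have h := add_mem (S := Submodule R (TotalFractions 𝒜)) ha hb
        rwa [← map_add] at h
      smul_mem' := fun c a ha => by
        have h := N.smul_mem (c : R) ha
        rwa [smul_toTotalFractions] at h }
  obtain ⟨a, ha, ha'⟩ := exists_mem_nonZeroDivisors hR J fun P hP hle => by
    obtain ⟨x, hx⟩ := exists_mem_annihilator_iff hR hP
    obtain ⟨n, ⟨m, hm, s, hms⟩, hn⟩ :=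
      exists_isLocalGenerator h2 (subGrading 𝒜 N) hdec hinv (IsAssociatedPrime.isPrime hP)
    obtain ⟨r, hr⟩ := hdN n n.2
    -- Both `d` and `n` are even, and the denominator `s` is an even non-zerodivisor, so it cannot
    -- kill a nonzero odd part of `r`.
    have hr0 : r ∈ 𝒜 0 := by
      have h : ((d • m) /ₒ s : TotalFractions 𝒜) = r /ₒ 1 := by
        rw [← EvenSubmonoid.smul_div, ← hms]
        exact hr
      obtain ⟨t, ht⟩ := EvenSubmonoid.div_eq_div h
      rw [one_smul] at ht
      have hdm : d • m = s • r := by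
        refine sub_eq_zero.1 ((mem_nonZeroDivisors_iff.1 t.2.2).1 _ ?_)
        rw [mul_sub]
        exact sub_eq_zero.2 ht
      obtain ⟨b, hb, c, hc, rfl⟩ := exists_eq_even_add_odd 𝒜 r
      rw [smul_add, ← add_zero (d • m)] at hdm
      have hsc := (even_odd_ext 𝒜 (even_smul_mem 𝒜 𝒜 ⟨d, hd0⟩ hm) (zero_mem _)
        ((evenNonZeroDivisors 𝒜).smul_mem 𝒜 s hb) ((evenNonZeroDivisors 𝒜).smul_mem 𝒜 s hc) hdm).2
      rw [(mem_nonZeroDivisors_iff.1 s.2.2).1 c hsc.symm, add_zero]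
      exact hb
    have hrJ : (⟨r, hr0⟩ : evenSubring 𝒜) ∈ J := by
      change toTotalFractions 𝒜 r ∈ N
      rw [← hr]
      exact N.smul_mem d n.2
    have hrx : r * x = 0 := (hx _).1 (hle hrJ)
    -- `(x * d) • n` is the image of `x * r = r * x = 0`; cancelling `d` from `t * x * d = 0` then
    -- puts `t` in `P`.
    obtain ⟨t, ht, h⟩ := hn.torsion (x * d) (Subtype.ext (by
      rw [Submodule.coe_smul, mul_smul, hr, smul_toTotalFractions,
        ← even_mul_comm 𝒜 ⟨r, hr0⟩ x, hrx, map_zero, Submodule.coe_zero]))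
    refine ht ((hx t).2 ((mem_nonZeroDivisors_iff.1 hd').2 _ ?_))
    rw [← h, Subring.smul_def, Subring.smul_def, smul_eq_mul, smul_eq_mul, mul_assoc]
  exact ⟨a, a.2, ha', ha⟩

end FractionalIdeals

end Super

theorem mainTheorem8 {R : Type u} [Ring R] [Nontrivial R]
    (𝒜 : ZMod 2 → AddSubgroup R) [GradedRing 𝒜] [Super.IsSupercommutative 𝒜]
    (h2 : (2 : R) ∈ nonZeroDivisors R) (hR : Super.IsNoetherianSuperring 𝒜) :
    (∀ (M : Type v) [AddCommGroup M] [Module R M] (ℳ : ZMod 2 → AddSubgroup M)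
        [DirectSum.Decomposition ℳ] [SetLike.GradedSMul 𝒜 ℳ],
        Super.IsInvertible 𝒜 ℳ →
        ∃ N : Submodule R (Super.TotalFractions 𝒜),
          Super.IsFractionalSuperideal 𝒜 N ∧ Super.SuperIso R ℳ (Super.subGrading 𝒜 N)) ∧
    (∀ N : Submodule R (Super.TotalFractions 𝒜),
        Super.IsFractionalSuperideal 𝒜 N → Super.IsInvertible 𝒜 (Super.subGrading 𝒜 N) →
        ∃ r : R, r ∈ 𝒜 0 ∧ r ∈ nonZeroDivisors R ∧ Super.toTotalFractions 𝒜 r ∈ N) := by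
  exact ⟨fun _ _ _ _ _ _ hM => hM.exists_fractionalSuperideal h2 hR,
    fun _ hN hinv => hN.exists_even_nonZeroDivisor h2 hR hinv⟩
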